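/- For $a,b\in\mathbb R$ put $C(a,b)=\begin{bmatrix}a&b\\-b&a\end{bmatrix}$, let $C_n(a,b)$ be the real $2n\times 2n$ block matrix with $n$ diagonal blocks $C(a,b)$, identity blocks $I_2$ on the first block superdiagonal and zeros elsewhere, and let $J_n(\lambda)$ be the $n\times n$ Jordan block with eigenvalue $\lambda$. Let $$J_R=\operatorname{diag}\bigl(C_{n_1}(a_1,b_1),\dots,C_{n_p}(a_p,b_p),J_{n_{p+1}}(\lambda_{p+1}),\dots,J_{n_{p+q}}(\lambda_{p+q})\bigr)$$ be a nonsingular real Jordan matrix, where $a_k,b_k,\lambda_{p+l}\in\mathbb R$, $b_k\neq0$ and all $n_k\ge1$; put $\lambda_k=a_k+ib_k$ for $k\le p$. Let $c$ be the number of distinct conjugate pairs $\{\lambda_k,\bar\lambda_k\}$, $k\le p$, and $r$ the number of distinct real eigenvalues $\lambda_{p+1},\dots,\lambda_{p+q}$. A complex matrix $X$ is a *function of* a complex square matrix $A$ if $X=f(A):=P(A)$ for some function $f$ defined on the spectrum of $A$. Here, if $\mu_1,\dots,\mu_s$ are the distinct eigenvalues of $A$ and $\nu_i$ is the order of the largest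 Jordan block of $A$ with eigenvalue $\mu_i$, *defined on the spectrum* means that the derivatives $f^{(d)}(\mu_i)$, $0\le d<\nu_i$, exist, and $P$ is the polynomial of degree less than $\sum_i\nu_i$ with $P^{(d)}(\mu_i)=f^{(d)}(\mu_i)$ for $0\le d<\nu_i$, $1\le i\le s$. For a real $\lambda\ne0$ and $i\in\{1,2\}$ let $L_n^{(i)}(\lambda)$ be the upper triangular Toeplitz matrix with entries $f^{(t-s)}(\lambda)/(t-s)!$ ($s\le t$), where $f$ is the $i$-th branch of $z^{1/2}$ near $\lambda$. For $b\neq0$ let the label $j\in\{1,2,3,4\}$ enumerate the choices of a branch $f$ of $z^{1/2}$ near each of the two points $a\pm ib$ (the same enumeration for $(a,b)$ and $(a,-b)$, by the branch at the point of the upper and the branch at the point of the lower half-plane). Let $F_n^{(j)}(a,b)$ be the block upper triangular, block Toeplitz matrix whose $d$-th block superdiagonal ($0\le d<n$) consists of the $2\times2$ blocks $$F_d=S\operatorname{diag}\Bigl(\tfrac{f^{(d)}(a+ib)}{d!},\tfrac{f^{(d)}(a-ib)}{d!}\Bigr)S^{-1},\qquad S=\begin{bmatrix}-i&-i\\1&-1\end{bmatrix}.$$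 For labels $j_1,\dots,j_p\in\{1,2,3,4\}$ and $i_1,\dots,i_q\in\{1,2\}$ put $$X(j,i)=\operatorname{diag}\bigl(F_{n_1}^{(j_1)},\dots,F_{n_p}^{(j_p)},L_{n_{p+1}}^{(i_1)},\dots,L_{n_{p+q}}^{(i_q)}\bigr),$$ where $F_{n_k}^{(j_k)}=F_{n_k}^{(j_k)}(a_k,b_k)$ and $L_{n_{p+l}}^{(i_l)}=L_{n_{p+l}}^{(i_l)}(\lambda_{p+l})$. Call $(j,i)$ admissible if blocks with the same conjugate pair of eigenvalues have the same label $j_k$, and blocks with the same real eigenvalue have the same label $i_l$. Then: 1. If $J_R$ has a negative real eigenvalue, then no real square root of $J_R$ is a function of $J_R$. 2. If $J_R$ has no negative real eigenvalue, then $J_R$ has precisely $2^{c+r}$ real square roots which are functions of $J_R$; they are the matrices $X(j,i)$ with $(j,i)$ admissible and all of $F_{n_1}^{(j_1)},\dots,F_{n_p}^{(j_p)}$ real. 3. If $J_R$ has no positive real eigenvalue, then $J_R$ has precisely $2^{c+r}$ pure imaginary square roots which are functions of $J_R$; they are the matrices $X(j,i)$ with $(j,i)$ admissible and all of $F_{n_1}^{(j_1)},\dots,F_{n_p}^{(j_p)}$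 pure imaginary. (A matrix is pure imaginary if all its entries have real part $0$.) -/

import Mathlib

open Filter Topology
open scoped ComplexConjugate

noncomputable section

/-! ### Functions of a matrix, by Hermite interpolation -/

section MatrixFunction

variable {ι : Type*} [Fintype ι] [DecidableEq ι]

/-- `μ` is an eigenvalue of the square matrix `A` over the field `K`. -/
def IsEigenvalue {K : Type*} [Field K] (A : Matrix ι ι K) (μ : K) : Prop :=
  Module.End.HasEigenvalue (Matrix.toLin' A) μ

/-- The index of `μ` in `A`: the least `k` from which on the subspaces `ker (A - μ)^k` are
constant. For an eigenvalue `μ` this is the order of the largest Jordan block of `A` in which `μ`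
appears. -/
def eigenIndex (A : Matrix ι ι ℂ) (μ : ℂ) : ℕ :=
  Module.End.maxGenEigenspaceIndex (Matrix.toLin' A) μ

/-- The derivatives of `f` of the orders `0, …, n - 1` exist at `μ`: those of order at most
`n - 2` exist in a neighbourhood of `μ`, and the one of order `n - 1` exists at `μ` itself. -/
def HasDerivsBelow (f : ℂ → ℂ) (μ : ℂ) (n : ℕ) : Prop :=
  (∀ j : ℕ, j + 2 < n → ∀ᶠ z in 𝓝 μ, DifferentiableAt ℂ (iteratedDeriv j f) z) ∧
    ∀ j : ℕ, j + 1 < n → DifferentiableAt ℂ (iteratedDeriv j f) μ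

/-- `f` is defined on the spectrum of `A`. -/
def DefinedOnSpectrum (f : ℂ → ℂ) (A : Matrix ι ι ℂ) : Prop :=
  ∀ μ : ℂ, IsEigenvalue A μ → HasDerivsBelow f μ (eigenIndex A μ)

/-- `p` is the Hermite interpolating polynomial of `f` on the spectrum of `A`: its degree is less
than the sum of the indices of the distinct eigenvalues of `A`, and it has the same values as `f`
on the spectrum of `A`. -/
def IsHermiteInterpolant (f : ℂ → ℂ) (A : Matrix ι ι ℂ) (p : Polynomial ℂ) : Prop :=
  p.degree < ((∑ᶠ μ ∈ {μ : ℂ | IsEigenvalue A μ}, eigenIndex A μ : ℕ) : WithBot ℕ) ∧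
    ∀ μ : ℂ, IsEigenvalue A μ → ∀ j : ℕ, j < eigenIndex A μ →
      (Polynomial.derivative^[j] p).eval μ = iteratedDeriv j f μ

/-- `X` is a function of `A`: `X = f(A) = p(A)` for some `f` defined on the spectrum of `A`, with
`p` the Hermite interpolating polynomial of `f`. -/
def IsFunctionOf (X A : Matrix ι ι ℂ) : Prop :=
  ∃ (f : ℂ → ℂ) (p : Polynomial ℂ),
    DefinedOnSpectrum f A ∧ IsHermiteInterpolant f A p ∧ X = Polynomial.aeval A p

/-- The square roots of `A` which are functions of `A`. -/
def sqrtFunctions (A : Matrix ι ι ℂ) : Set (Matrix ι ι ℂ) :=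
  {X | X * X = A ∧ IsFunctionOf X A}

end MatrixFunction

/-- All entries of `X` are real. -/
def IsRealMatrix {ι : Type*} (X : Matrix ι ι ℂ) : Prop := ∀ i j, (X i j).im = 0

/-- All entries of `X` are pure imaginary, that is, `X = i Y` with `Y` real. -/
def IsPureImaginaryMatrix {ι : Type*} (X : Matrix ι ι ℂ) : Prop := ∀ i j, (X i j).re = 0

/-! ### Real Jordan matrices -/

/-- The canonical Jordan block `J_n(x)` with real eigenvalue `x`. -/
def jordanBlockReal (n : ℕ) (x : ℝ) : Matrix (Fin n) (Fin n) ℝ :=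
  Matrix.of fun s t =>
    if s = t then x else if (s : ℕ) + 1 = (t : ℕ) then 1 else 0

/-- The matrix `C(a, b)`. -/
def matC (a b : ℝ) : Matrix (Fin 2) (Fin 2) ℝ := !![a, b; -b, a]

/-- The real Jordan block `C_n(a, b)`: an `n × n` array of `2 × 2` blocks, with `C(a, b)` on the
diagonal and the identity on the first superdiagonal. The index `(s, u)` is row (or column) `u` of
the `s`-th block row (or column). -/
def realJordanBlock (n : ℕ) (a b : ℝ) : Matrix (Fin n × Fin 2) (Fin n × Fin 2) ℝ :=
  Matrix.of fun x y =>
    if x.1 = y.1 then matC a b x.2 y.2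
    else if (x.1 : ℕ) + 1 = (y.1 : ℕ) then (1 : Matrix (Fin 2) (Fin 2) ℝ) x.2 y.2 else 0

/-- The data of a real Jordan matrix: `p` real Jordan blocks `C_{m_k}(a_k, b_k)` with `b_k ≠ 0`,
followed by `q` canonical Jordan blocks `J_{n_l}(x_l)` with real `x_l`; all blocks nonempty. -/
structure RealJordan where
  p : ℕ
  q : ℕ
  m : Fin p → ℕ
  a : Fin p → ℝ
  b : Fin p → ℝ
  n : Fin q → ℕ
  x : Fin q → ℝ
  m_pos : ∀ k, 0 < m k
  n_pos : ∀ l, 0 < n l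
  b_ne_zero : ∀ k, b k ≠ 0

namespace RealJordan

/-- The index type of the rows and columns; it has `2 (m_1 + ⋯ + m_p) + (n_1 + ⋯ + n_q)`
elements. -/
abbrev Idx (D : RealJordan) : Type :=
  (Σ k : Fin D.p, Fin (D.m k) × Fin 2) ⊕ (Σ l : Fin D.q, Fin (D.n l))

/-- The block diagonal matrix with the given diagonal blocks. -/
def blockDiag {R : Type} [Zero R] (D : RealJordan)
    (F : ∀ k : Fin D.p, Matrix (Fin (D.m k) × Fin 2) (Fin (D.m k) × Fin 2) R)
    (L : ∀ l : Fin D.q, Matrix (Fin (D.n l)) (Fin (D.n l)) R) : Matrix D.Idx D.Idx R :=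
  Matrix.fromBlocks (Matrix.blockDiagonal' F) 0 0 (Matrix.blockDiagonal' L)

/-- The real Jordan matrix `J_R`. -/
def toMatrix (D : RealJordan) : Matrix D.Idx D.Idx ℝ :=
  D.blockDiag (fun k => realJordanBlock (D.m k) (D.a k) (D.b k))
    (fun l => jordanBlockReal (D.n l) (D.x l))

/-- `J_R` as a complex matrix. -/
def toComplex (D : RealJordan) : Matrix D.Idx D.Idx ℂ := D.toMatrix.map Complex.ofReal

/-- The nonreal eigenvalue `a_k + i b_k` of the `k`-th real Jordan block. -/
def lam (D : RealJordan) (k : Fin D.p) : ℂ := ⟨D.a k, D.b k⟩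

/-- The number `c` of distinct (unordered) complex conjugate eigenvalue pairs. -/
def c (D : RealJordan) : ℕ := (Set.range fun k => s(D.lam k, conj (D.lam k))).ncard

/-- The number `r` of distinct real eigenvalues. -/
def r (D : RealJordan) : ℕ := (Set.range D.x).ncard

end RealJordan

/-! ### The blocks of the square roots -/

/-- The branch number `j` of the square root near `μ ≠ 0`: it takes the value `(-1)^j μ^{1/2}`
(principal root) at `μ`, is holomorphic near `μ`, and its square is `z` at `z`. -/
def sqrtBranch (j : Fin 2) (μ z : ℂ) : ℂ :=
  (-1) ^ (j : ℕ) * μ ^ (1 / 2 : ℂ) * (z / μ) ^ (1 / 2 : ℂ)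

/-- The Taylor coefficient `f^{(d)}(μ) / d!` of the branch number `j` of the square root at `μ`. -/
def sqrtCoeff (j : Fin 2) (μ : ℂ) (d : ℕ) : ℂ :=
  iteratedDeriv d (sqrtBranch j μ) μ / (d.factorial : ℂ)

/-- The upper triangular Toeplitz square root `L_n^{(j)}` of `J_n(x)`, with entries
`f^{(t - s)}(x) / (t - s)!` where `f` is the branch number `j` of the square root near `x`. -/
def blockL (n : ℕ) (x : ℝ) (j : Fin 2) : Matrix (Fin n) (Fin n) ℂ :=
  Matrix.of fun s t =>
    if (s : ℕ) ≤ (t : ℕ) then sqrtCoeff j (x : ℂ) ((t : ℕ) - (s : ℕ)) else 0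

/-- A label `j = (j₁, j₂)` selects a branch of the square root near every nonreal number: branch
`j₁` in the upper and branch `j₂` in the lower half-plane. -/
def branchAt (j : Fin 2 × Fin 2) (μ : ℂ) : Fin 2 := if 0 < μ.im then j.1 else j.2

/-- The `2 × 2` matrix `S diag(u, v) S⁻¹` with `S = [-i, -i; 1, -1]`, the similarity for which
`C(a, b) = S diag(a + ib, a - ib) S⁻¹`. -/
def conjDiag (u v : ℂ) : Matrix (Fin 2) (Fin 2) ℂ :=
  !![(u + v) / 2, (u - v) / (2 * Complex.I);
    -((u - v) / (2 * Complex.I)), (u + v) / 2]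

/-- The `2 × 2` block `F_d` of the square root of `C_n(a, b)` with label `j`. With `f` the branches
selected by `j` near `μ = a + ib` and near its conjugate, `F_d` is
`S diag(f^{(d)}(μ) / d!, f^{(d)}(conj μ) / d!) S⁻¹`; in particular `F_0 = F^{(j)}` is one of the
four square roots of `C(a, b)`. -/
def coeffF (a b : ℝ) (j : Fin 2 × Fin 2) (d : ℕ) : Matrix (Fin 2) (Fin 2) ℂ :=
  let μ : ℂ := ⟨a, b⟩
  conjDiag (sqrtCoeff (branchAt j μ) μ d) (sqrtCoeff (branchAt j (conj μ)) (conj μ) d)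

/-- The block upper triangular, block Toeplitz square root `F_n^{(j)}` of `C_n(a, b)`. -/
def blockF (n : ℕ) (a b : ℝ) (j : Fin 2 × Fin 2) :
    Matrix (Fin n × Fin 2) (Fin n × Fin 2) ℂ :=
  Matrix.of fun x y =>
    if (x.1 : ℕ) ≤ (y.1 : ℕ) then coeffF a b j ((y.1 : ℕ) - (x.1 : ℕ)) x.2 y.2 else 0

namespace RealJordan

/-- The constraint on the choices of labels: blocks with the same real eigenvalue, or with the same
pair of conjugate eigenvalues, get the same label. -/
def Admissible (D : RealJordan) (j : Fin D.p → Fin 2 × Fin 2) (i : Fin D.q → Fin 2) : Prop :=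
  (∀ k l, D.lam k = D.lam l ∨ D.lam k = conj (D.lam l) → j k = j l) ∧
    ∀ k l, D.x k = D.x l → i k = i l

/-- The matrix `diag(F_{m_1}^{(j_1)}, …, F_{m_p}^{(j_p)}, L_{n_1}^{(i_1)}, …, L_{n_q}^{(i_q)})`. -/
def blockSqrt (D : RealJordan) (j : Fin D.p → Fin 2 × Fin 2) (i : Fin D.q → Fin 2) :
    Matrix D.Idx D.Idx ℂ :=
  D.blockDiag (fun k => blockF (D.m k) (D.a k) (D.b k) (j k))
    (fun l => blockL (D.n l) (D.x l) (i l))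

end RealJordan

end

noncomputable section

/-! The functions of a matrix are exactly its polynomials (`isFunctionOf_iff_exists_aeval`), so the
task is to find all `P` with `P(J_R)² = J_R`. The map `blockToeplitzHom` is an algebra homomorphism
from a product of power series rings, two factors for each real Jordan block (at `λ` and its
conjugate) and one for each canonical block. It sends the tuple of the `X + μ` to `J_R`, hence the
Taylor expansions of `P` to `P(J_R)`, and it sees each factor exactly modulo `X ^ n`, with `n` the
block size.

In each factor the equation reads `g² ≡ X + μ` with `μ ≠ 0`. If `s` is the branch with the same
constant term, then `g² - s² = (g - s)(g + s)` and `g + s` is a unit, so `g ≡ s`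
(`X_pow_dvd_sub_sqrtSeries`). Thus `P` selects one branch at each eigenvalue, which is
admissibility; conversely Hermite interpolation realizes every such selection
(`mem_sqrtFunctions_toComplex_iff`), and distinct labels give distinct matrices.

A block `L` is real for a positive eigenvalue and pure imaginary, with nonzero diagonal, for a
negative one. Principal branches at `μ` and `conj μ` are conjugate off the negative axis, so `F` is
real iff its two branch numbers agree and pure imaginary iff they differ. Either way one binary
choice remains for each conjugate pair and one for each real eigenvalue. -/

theorem iteratedDeriv_polynomial_eval (p : Polynomial ℂ) (j : ℕ) :
    iteratedDeriv j (fun z => p.eval z) = fun z => (Polynomial.derivative^[j] p).eval z := by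
  induction j with
  | zero => simp
  | succ j ih =>
    rw [iteratedDeriv_succ, ih]
    funext z
    rw [Polynomial.deriv, Function.iterate_succ_apply']

/-! ### Functions of a matrix are its polynomials -/

section MatrixFunction

variable {ι : Type*} [Fintype ι] [DecidableEq ι]

theorem finite_setOf_isEigenvalue (A : Matrix ι ι ℂ) : {μ : ℂ | IsEigenvalue A μ}.Finite :=
  Module.End.finite_hasEigenvalue (Matrix.toLin' A)

/-- The product of the `(X - μ) ^ (index of μ)` over all eigenvalues `μ` annihilates `A`. -/
theorem aeval_prod_X_sub_C_pow_eigenIndex (A : Matrix ι ι ℂ) :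
    Polynomial.aeval A (∏ μ ∈ (finite_setOf_isEigenvalue A).toFinset,
      (Polynomial.X - Polynomial.C μ) ^ eigenIndex A μ) = 0 := by
  set m := ∏ μ ∈ (finite_setOf_isEigenvalue A).toFinset,
      (Polynomial.X - Polynomial.C μ) ^ eigenIndex A μ with hm
  have key : Polynomial.aeval (Matrix.toLin' A) m = 0 := by
    -- The generalized eigenspaces span the space, and the factor of `μ` already kills the
    -- generalized eigenspace of `μ`.
    rw [← LinearMap.ker_eq_top, ← top_le_iff,
      ← Module.End.iSup_maxGenEigenspace_eq_top (Matrix.toLin' A)]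
    refine iSup_le fun μ => ?_
    by_cases hμ : IsEigenvalue A μ
    · intro v hv
      rw [Module.End.maxGenEigenspace_eq, Module.End.mem_genEigenspace_nat, LinearMap.mem_ker] at hv
      have hmem : μ ∈ (finite_setOf_isEigenvalue A).toFinset := by simpa using hμ
      rw [hm, ← Finset.prod_erase_mul _ _ hmem, LinearMap.mem_ker, map_mul, Module.End.mul_apply]
      have : Polynomial.aeval (Matrix.toLin' A)
          ((Polynomial.X - Polynomial.C μ) ^ eigenIndex A μ) v = 0 := by
        rw [← hv]
        simp [eigenIndex, Algebra.algebraMap_eq_smul_one]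
      rw [this, map_zero]
    · have : Module.End.maxGenEigenspace (Matrix.toLin' A) μ = ⊥ := by
        by_contra h
        exact hμ (Module.End.HasUnifEigenvalue.lt (k := ⊤) zero_lt_one h)
      rw [this]
      exact bot_le
  have h2 : Polynomial.aeval (Matrix.toLinAlgEquiv' A) m = 0 := key
  rw [Polynomial.aeval_algEquiv] at h2
  simpa using h2

/-- The functions of a complex matrix are its polynomials. -/
theorem isFunctionOf_iff_exists_aeval (X A : Matrix ι ι ℂ) :
    IsFunctionOf X A ↔ ∃ P : Polynomial ℂ, X = Polynomial.aeval A P := by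
  constructor
  · rintro ⟨f, p, -, -, h⟩
    exact ⟨p, h⟩
  rintro ⟨P, rfl⟩
  set m := ∏ μ ∈ (finite_setOf_isEigenvalue A).toFinset,
      (Polynomial.X - Polynomial.C μ) ^ eigenIndex A μ with hm
  have hmonic : m.Monic :=
    Polynomial.monic_prod_of_monic _ _ fun μ _ => (Polynomial.monic_X_sub_C μ).pow _
  have hdeg : m.degree = ((∑ᶠ μ ∈ {μ : ℂ | IsEigenvalue A μ}, eigenIndex A μ : ℕ) :
      WithBot ℕ) := by
    rw [finsum_mem_eq_finite_toFinset_sum _ (finite_setOf_isEigenvalue A), hm,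
      Polynomial.degree_prod]
    simp
  -- The remainder has the required degree and the same value at `A`, since `m` annihilates `A`; it
  -- then serves as its own interpolated function.
  set p := P %ₘ m
  have hd (j : ℕ) : Differentiable ℂ (iteratedDeriv j (fun z => p.eval z)) := by
    rw [iteratedDeriv_polynomial_eval]
    exact Polynomial.differentiable _
  refine ⟨fun z => p.eval z, p, fun μ _ => ⟨fun j _ => .of_forall fun z => hd j z,
    fun j _ => hd j μ⟩, ⟨?_, fun μ _ j _ => ?_⟩, ?_⟩
  · rw [← hdeg]
    exact Polynomial.degree_modByMonic_lt _ hmonic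
  · rw [iteratedDeriv_polynomial_eval]
  · exact (Polynomial.aeval_modByMonic_eq_self_of_root
      (aeval_prod_X_sub_C_pow_eigenIndex A)).symm

theorem mem_sqrtFunctions_iff (X A : Matrix ι ι ℂ) :
    X ∈ sqrtFunctions A ↔ X * X = A ∧ ∃ P : Polynomial ℂ, X = Polynomial.aeval A P := by
  rw [← isFunctionOf_iff_exists_aeval]; rfl

end MatrixFunction

/-! ### Power series of the branches of the square root -/

/-- The Taylor series at `μ` of the branch number `j` of the square root. -/
def sqrtSeries (j : Fin 2) (μ : ℂ) : PowerSeries ℂ := PowerSeries.mk (sqrtCoeff j μ)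

@[simp] theorem coeff_sqrtSeries (j : Fin 2) (μ : ℂ) (d : ℕ) :
    PowerSeries.coeff d (sqrtSeries j μ) = sqrtCoeff j μ d := by simp [sqrtSeries]

theorem sqrtCoeff_zero (j : Fin 2) {μ : ℂ} (hμ : μ ≠ 0) :
    sqrtCoeff j μ 0 = (-1) ^ (j : ℕ) * μ ^ (1 / 2 : ℂ) := by
  simp [sqrtCoeff, sqrtBranch, hμ]

theorem cpow_half_mul_self (z : ℂ) (hz : z ≠ 0) : z ^ (1 / 2 : ℂ) * z ^ (1 / 2 : ℂ) = z := by
  rw [← Complex.cpow_add _ _ hz]; norm_num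

theorem sqrtCoeff_zero_mul_self (j : Fin 2) {μ : ℂ} (hμ : μ ≠ 0) :
    sqrtCoeff j μ 0 * sqrtCoeff j μ 0 = μ := by
  rw [sqrtCoeff_zero j hμ, mul_mul_mul_comm, cpow_half_mul_self μ hμ, ← pow_add, ← two_mul,
    pow_mul]
  simp

theorem sqrtCoeff_zero_ne_zero (j : Fin 2) {μ : ℂ} (hμ : μ ≠ 0) : sqrtCoeff j μ 0 ≠ 0 := by
  intro h
  have := sqrtCoeff_zero_mul_self j hμ
  rw [h, zero_mul] at this
  exact hμ this.symm

theorem analyticAt_sqrtBranch (j : Fin 2) {μ : ℂ} (hμ : μ ≠ 0) :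
    AnalyticAt ℂ (sqrtBranch j μ) μ := by
  unfold sqrtBranch
  refine AnalyticAt.mul analyticAt_const (AnalyticAt.cpow ?_ analyticAt_const ?_)
  · exact analyticAt_id.div analyticAt_const hμ
  · simp [hμ, Complex.one_mem_slitPlane]

theorem sqrtBranch_mul_self (j : Fin 2) {μ z : ℂ} (hμ : μ ≠ 0) (hz : z ≠ 0) :
    sqrtBranch j μ z * sqrtBranch j μ z = z := by
  have h1 := cpow_half_mul_self μ hμ
  have h2 := cpow_half_mul_self (z / μ) (div_ne_zero hz hμ)
  have h3 : ((-1 : ℂ) ^ (j : ℕ)) * (-1) ^ (j : ℕ) = 1 := by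
    rw [← pow_add, ← two_mul, pow_mul]; simp
  unfold sqrtBranch
  calc _ = ((-1 : ℂ) ^ (j : ℕ)) * (-1) ^ (j : ℕ) * (μ ^ (1 / 2 : ℂ) * μ ^ (1 / 2 : ℂ)) *
        ((z / μ) ^ (1 / 2 : ℂ) * (z / μ) ^ (1 / 2 : ℂ)) := by ring
    _ = z := by rw [h1, h2, h3]; field_simp

/-- The Taylor series of a product is the product of the Taylor series. -/
theorem mk_iteratedDeriv_mul {f g : ℂ → ℂ} {μ : ℂ} (hf : AnalyticAt ℂ f μ)
    (hg : AnalyticAt ℂ g μ) :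
    PowerSeries.mk (fun d => iteratedDeriv d (f * g) μ / (d.factorial : ℂ)) =
      PowerSeries.mk (fun d => iteratedDeriv d f μ / (d.factorial : ℂ)) *
        PowerSeries.mk (fun d => iteratedDeriv d g μ / (d.factorial : ℂ)) := by
  ext d
  rw [PowerSeries.coeff_mk, PowerSeries.coeff_mul, iteratedDeriv_mul hf.contDiffAt hg.contDiffAt,
    Finset.Nat.sum_antidiagonal_eq_sum_range_succ_mk, Finset.sum_div]
  refine Finset.sum_congr rfl fun k hk => ?_
  have hk' : k ≤ d := by simpa [Nat.lt_succ_iff] using hk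
  simp only [PowerSeries.coeff_mk]
  rw [Nat.cast_choose ℂ hk']
  have h1 : (k.factorial : ℂ) ≠ 0 := by exact_mod_cast k.factorial_ne_zero
  have h2 : ((d - k).factorial : ℂ) ≠ 0 := by exact_mod_cast (d - k).factorial_ne_zero
  have h3 : (d.factorial : ℂ) ≠ 0 := by exact_mod_cast d.factorial_ne_zero
  field_simp

/-- The branch squares to `z` at every `z ≠ 0`, hence near `μ`, and Taylor expansion is
multiplicative. -/
theorem sqrtSeries_mul_self (j : Fin 2) {μ : ℂ} (hμ : μ ≠ 0) :
    sqrtSeries j μ * sqrtSeries j μ = PowerSeries.X + PowerSeries.C μ := by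
  have h := mk_iteratedDeriv_mul (analyticAt_sqrtBranch j hμ) (analyticAt_sqrtBranch j hμ)
  have hE : sqrtBranch j μ * sqrtBranch j μ =ᶠ[𝓝 μ] fun z => (Polynomial.X : Polynomial ℂ).eval z :=
    (eventually_ne_nhds hμ).mono fun z hz => by simpa using sqrtBranch_mul_self j hμ hz
  have : sqrtSeries j μ * sqrtSeries j μ = PowerSeries.mk (fun d =>
      iteratedDeriv d (sqrtBranch j μ * sqrtBranch j μ) μ / (d.factorial : ℂ)) := h.symm
  rw [this]
  ext d
  rw [PowerSeries.coeff_mk, hE.iteratedDeriv_eq d, iteratedDeriv_polynomial_eval]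
  rcases d with _ | _ | d
  · simp
  · simp [PowerSeries.coeff_X]
  · simp [PowerSeries.coeff_X]

/-- A power series whose square is `X + μ` modulo `X ^ n` agrees modulo `X ^ n` with the Taylor
series of the branch of the square root with the same constant term. -/
theorem X_pow_dvd_sub_sqrtSeries {n : ℕ} {j : Fin 2} {μ : ℂ} (hμ : μ ≠ 0) {g : PowerSeries ℂ}
    (hg : PowerSeries.X ^ n ∣ g * g - (PowerSeries.X + PowerSeries.C μ))
    (h0 : PowerSeries.constantCoeff g = sqrtCoeff j μ 0) :
    PowerSeries.X ^ n ∣ g - sqrtSeries j μ := by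
  -- The constant term of the sum is twice a square root of `μ ≠ 0`.
  have hu : IsUnit (g + sqrtSeries j μ) := by
    rw [PowerSeries.isUnit_iff_constantCoeff, map_add, h0,
      ← PowerSeries.coeff_zero_eq_constantCoeff_apply, coeff_sqrtSeries, isUnit_iff_ne_zero,
      ← two_mul]
    exact mul_ne_zero two_ne_zero (sqrtCoeff_zero_ne_zero j hμ)
  rw [← hu.dvd_mul_right]
  rw [← sqrtSeries_mul_self j hμ] at hg
  convert hg using 1
  ring

theorem eq_sqrtSeries {j : Fin 2} {μ : ℂ} (hμ : μ ≠ 0) {g : PowerSeries ℂ}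
    (hg : g * g = PowerSeries.X + PowerSeries.C μ)
    (h0 : PowerSeries.constantCoeff g = sqrtCoeff j μ 0) : g = sqrtSeries j μ := by
  ext d
  have := X_pow_dvd_sub_sqrtSeries (n := d + 1) hμ (by rw [hg, sub_self]; exact dvd_zero _) h0
  rw [PowerSeries.X_pow_dvd_iff] at this
  simpa [sub_eq_zero] using this d (Nat.lt_succ_self d)

theorem sqrtCoeff_one (μ : ℂ) (d : ℕ) : sqrtCoeff 1 μ d = -sqrtCoeff 0 μ d := by
  have : sqrtBranch 1 μ = -sqrtBranch 0 μ := by funext z; simp [sqrtBranch]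
  rw [sqrtCoeff, this, iteratedDeriv_neg]
  simp [sqrtCoeff, neg_div]

theorem exists_eq_sqrtCoeff_zero {μ u : ℂ} (hμ : μ ≠ 0) (h : u * u = μ) :
    ∃ j : Fin 2, u = sqrtCoeff j μ 0 := by
  rw [← sqrtCoeff_zero_mul_self 0 hμ, mul_self_eq_mul_self_iff] at h
  rcases h with h | h
  · exact ⟨0, h⟩
  · exact ⟨1, by rw [h, sqrtCoeff_one]⟩

theorem sqrtCoeff_zero_injective {μ : ℂ} (hμ : μ ≠ 0) :
    Function.Injective fun j : Fin 2 => sqrtCoeff j μ 0 := by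
  have h0 := sqrtCoeff_zero_ne_zero 0 hμ
  have hne : sqrtCoeff 0 μ 0 ≠ -sqrtCoeff 0 μ 0 := fun h => h0 (self_eq_neg.mp h)
  intro j k h
  fin_cases j <;> fin_cases k <;> simp_all [sqrtCoeff_one]

/-- Conjugating coefficients turns a square root of `X + μ` into one of `X + conj μ`, and such a
root is determined by its constant term. -/
theorem conj_sqrtCoeff_of_zero {j k : Fin 2} {μ : ℂ} (hμ : μ ≠ 0)
    (h0 : conj (sqrtCoeff j μ 0) = sqrtCoeff k (conj μ) 0) (d : ℕ) :
    conj (sqrtCoeff j μ d) = sqrtCoeff k (conj μ) d := by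
  have hμ' : conj μ ≠ 0 := by simpa using hμ
  have : PowerSeries.map (starRingEnd ℂ) (sqrtSeries j μ) = sqrtSeries k (conj μ) := by
    refine eq_sqrtSeries hμ' ?_ ?_
    · rw [← map_mul, sqrtSeries_mul_self j hμ]; simp
    · rw [← PowerSeries.coeff_zero_eq_constantCoeff_apply, PowerSeries.coeff_map,
        coeff_sqrtSeries, h0]
  simpa using congrArg (PowerSeries.coeff d) this

/-- Away from the negative real axis, branches with the same number are conjugate. -/
theorem conj_sqrtCoeff (j : Fin 2) {μ : ℂ} (hμ : μ ≠ 0) (h : μ.arg ≠ Real.pi) (d : ℕ) :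
    conj (sqrtCoeff j μ d) = sqrtCoeff j (conj μ) d := by
  have hμ' : conj μ ≠ 0 := by simpa using hμ
  refine conj_sqrtCoeff_of_zero hμ ?_ d
  -- Conjugation commutes with the principal root only off the cut; `arg (conj μ) = -arg μ` is not
  -- `π` because `arg μ > -π`.
  have := Complex.cpow_conj (conj μ) (1 / 2) (by
    rw [Complex.arg_conj, if_neg h]
    have := Complex.neg_pi_lt_arg μ
    intro h'; linarith)
  rw [sqrtCoeff_zero j hμ, sqrtCoeff_zero j hμ', map_mul, map_pow]
  simp only [Complex.conj_conj, map_div₀, map_one, map_ofNat, map_neg] at this ⊢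
  rw [this]

theorem sqrtCoeff_ofReal_im (j : Fin 2) {x : ℝ} (hx : 0 < x) (d : ℕ) :
    (sqrtCoeff j x d).im = 0 := by
  rw [← Complex.conj_eq_iff_im, conj_sqrtCoeff j (by exact_mod_cast hx.ne')
    (by rw [Complex.arg_ofReal_of_nonneg hx.le]; exact Real.pi_pos.ne) d, Complex.conj_ofReal]

/-- A square root of a negative real is the negative of its conjugate. Conjugation therefore
exchanges the two branches at `x`, so every Taylor coefficient is the negative of its conjugate. -/
theorem sqrtCoeff_ofReal_re (j : Fin 2) {x : ℝ} (hx : x < 0) (d : ℕ) :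
    (sqrtCoeff j x d).re = 0 := by
  have hx' : (x : ℂ) ≠ 0 := by exact_mod_cast hx.ne
  have h1 : conj (sqrtCoeff j x 0) = -sqrtCoeff j x 0 := by
    have hs := sqrtCoeff_zero_mul_self j hx'
    have h := congrArg (starRingEnd ℂ) hs
    rw [Complex.conj_ofReal, map_mul] at h
    replace h := h.trans hs.symm
    rw [mul_self_eq_mul_self_iff] at h
    refine h.resolve_left fun h => ?_
    rw [Complex.conj_eq_iff_im] at h
    have := congrArg Complex.re hs
    rw [Complex.mul_re, h, Complex.ofReal_re] at this
    nlinarith [mul_self_nonneg (sqrtCoeff j (x : ℂ) 0).re]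
  obtain ⟨k, hk⟩ : ∃ k, ∀ d, sqrtCoeff k (x : ℂ) d = -sqrtCoeff j x d := by
    fin_cases j
    · exact ⟨1, sqrtCoeff_one _⟩
    · exact ⟨0, fun d => by simp [sqrtCoeff_one]⟩
  have h2 := conj_sqrtCoeff_of_zero (j := j) (k := k) hx'
    (by rw [h1, Complex.conj_ofReal, hk]) d
  rw [Complex.conj_ofReal, hk] at h2
  have := congrArg Complex.re h2
  simp at this
  linarith

/-! ### Taylor polynomials as power series -/

/-- The Taylor expansion of the polynomial `P` at `μ`. -/
abbrev taylorSeries (μ : ℂ) (P : Polynomial ℂ) : PowerSeries ℂ :=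
  Polynomial.aeval (PowerSeries.X + PowerSeries.C μ) P

theorem taylorSeries_eq_coe (μ : ℂ) (P : Polynomial ℂ) :
    taylorSeries μ P = ((P.comp (Polynomial.X + Polynomial.C μ) : Polynomial ℂ) :
      PowerSeries ℂ) := by
  induction P using Polynomial.induction_on' with
  | add p q hp hq => simp only [taylorSeries, map_add, Polynomial.add_comp, Polynomial.coe_add] at *
                     rw [hp, hq]
  | monomial n a =>
    simp [taylorSeries, Polynomial.aeval_monomial]

theorem constantCoeff_taylorSeries (μ : ℂ) (P : Polynomial ℂ) :
    PowerSeries.constantCoeff (taylorSeries μ P) = P.eval μ := by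
  rw [taylorSeries_eq_coe, Polynomial.constantCoeff_coe, Polynomial.coeff_zero_eq_eval_zero]
  simp

/-- Hermite interpolation: Taylor expansions can be prescribed at finitely many points. -/
theorem exists_taylorSeries_sub_dvd (s : Finset ℂ) (N : ℕ) (g : ℂ → PowerSeries ℂ) :
    ∃ P : Polynomial ℂ, ∀ μ ∈ s, PowerSeries.X ^ N ∣ taylorSeries μ P - g μ := by
  have hc : Pairwise (Function.onFun IsCoprime fun μ : s =>
      Ideal.span {(Polynomial.X - Polynomial.C (μ : ℂ)) ^ N}) := by
    intro μ ν h
    rw [Function.onFun, Ideal.isCoprime_span_singleton_iff]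
    exact (Polynomial.pairwise_coprime_X_sub_C (s := fun μ : s => (μ : ℂ))
      Subtype.val_injective h).pow
  -- Chinese remainder theorem for the pairwise coprime `(X - μ) ^ N`; the targets are the
  -- truncations of `g μ` recentred at `μ`.
  obtain ⟨P, hP⟩ := Ideal.exists_forall_sub_mem_ideal hc
    fun μ => (PowerSeries.trunc N (g μ)).comp (Polynomial.X - Polynomial.C (μ : ℂ))
  refine ⟨P, fun μ hμ => ?_⟩
  have h := hP ⟨μ, hμ⟩
  rw [Ideal.mem_span_singleton, Polynomial.X_sub_C_pow_dvd_iff, Polynomial.sub_comp,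
    Polynomial.comp_assoc] at h
  simp only [Polynomial.sub_comp, Polynomial.X_comp, Polynomial.C_comp, add_sub_cancel_right,
    Polynomial.comp_X] at h
  rw [PowerSeries.X_pow_dvd_iff]
  intro m hm
  rw [Polynomial.X_pow_dvd_iff] at h
  have h' := h m hm
  rw [Polynomial.coeff_sub, PowerSeries.coeff_trunc, if_pos hm] at h'
  rw [taylorSeries_eq_coe, map_sub, Polynomial.coeff_coe, h']

/-! ### Toeplitz matrices of power series -/

open scoped Kronecker

/-- The upper triangular Toeplitz matrix of a power series. -/
def toeplitz (n : ℕ) (f : PowerSeries ℂ) : Matrix (Fin n) (Fin n) ℂ :=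
  Matrix.of fun s t =>
    if (s : ℕ) ≤ (t : ℕ) then PowerSeries.coeff ((t : ℕ) - (s : ℕ)) f else 0

theorem toeplitz_apply (n : ℕ) (f : PowerSeries ℂ) (s t : Fin n) :
    toeplitz n f s t =
      if (s : ℕ) ≤ (t : ℕ) then PowerSeries.coeff ((t : ℕ) - (s : ℕ)) f else 0 := rfl

theorem toeplitz_add (n : ℕ) (f g : PowerSeries ℂ) :
    toeplitz n (f + g) = toeplitz n f + toeplitz n g := by
  ext s t
  simp only [toeplitz_apply, Matrix.add_apply, map_add]
  split_ifs <;> simp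

theorem toeplitz_C (n : ℕ) (a : ℂ) : toeplitz n (PowerSeries.C a) = a • 1 := by
  ext s t
  simp only [toeplitz_apply, Matrix.smul_apply, Matrix.one_apply, PowerSeries.coeff_C, Fin.ext_iff]
  split_ifs <;> first | omega | simp

theorem toeplitz_mul (n : ℕ) (f g : PowerSeries ℂ) :
    toeplitz n (f * g) = toeplitz n f * toeplitz n g := by
  ext s t
  rw [Matrix.mul_apply]
  simp only [toeplitz_apply]
  split_ifs with h
  · rw [PowerSeries.coeff_mul]
    symm
    -- Only `s ≤ u ≤ t` contribute to the matrix product; `u ↦ (u - s, t - u)` matches them with the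
    -- antidiagonal of `t - s` in the Cauchy product.
    refine Finset.sum_bij_ne_zero (fun u _ _ => ((u : ℕ) - (s : ℕ), (t : ℕ) - (u : ℕ))) ?_ ?_ ?_ ?_
    · intro u _ hu
      split_ifs at hu with h1 h2 <;> simp at hu ⊢
      omega
    · intro u _ hu v _ hv huv
      split_ifs at hu with h1 h2 <;> simp at hu
      split_ifs at hv with h3 h4 <;> simp at hv
      simp only [Prod.mk.injEq] at huv
      ext; omega
    · rintro ⟨a, b⟩ hab hne
      replace hab : a + b = t - s := Finset.HasAntidiagonal.mem_antidiagonal.mp hab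
      have h1 : (s : ℕ) ≤ s + a := by omega
      have h2 : (s : ℕ) + a ≤ t := by omega
      have h3 : (s : ℕ) + a - s = a := by omega
      have h4 : (t : ℕ) - (s + a) = b := by omega
      refine ⟨⟨s + a, by omega⟩, Finset.mem_univ _, ?_, ?_⟩
      · rw [if_pos h1, if_pos h2, h3, h4]
        exact hne
      · simp only [h3, h4]
    · intro u _ hu
      split_ifs at hu with h1 h2 <;> simp at hu
      simp only [if_pos h1, if_pos h2]
  · refine (Finset.sum_eq_zero fun u _ => ?_).symm
    split_ifs <;> first | omega | simp

theorem toeplitz_X_add_C (n : ℕ) (x : ℝ) :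
    toeplitz n (PowerSeries.X + PowerSeries.C (x : ℂ)) =
      (jordanBlockReal n x).map Complex.ofReal := by
  ext s t
  simp only [toeplitz_apply, jordanBlockReal, Matrix.map_apply, Matrix.of_apply, map_add,
    PowerSeries.coeff_X, PowerSeries.coeff_C, Fin.ext_iff]
  split_ifs <;> first | omega | simp

theorem toeplitz_sqrtSeries (n : ℕ) (x : ℝ) (j : Fin 2) :
    toeplitz n (sqrtSeries j x) = blockL n x j := by
  ext s t
  simp [toeplitz_apply, blockL]

/-- The first row displays all coefficients of degree below `n`, and no others occur in the matrix.
-/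
theorem toeplitz_eq_iff {n : ℕ} {f g : PowerSeries ℂ} :
    toeplitz n f = toeplitz n g ↔ PowerSeries.X ^ n ∣ f - g := by
  rw [PowerSeries.X_pow_dvd_iff]
  constructor
  · intro h m hm
    have := congrFun₂ h ⟨0, by omega⟩ ⟨m, hm⟩
    simpa [toeplitz_apply, sub_eq_zero] using this
  · intro h
    ext s t
    simp only [toeplitz_apply]
    split_ifs
    · have := h ((t : ℕ) - s) (by omega)
      rwa [map_sub, sub_eq_zero] at this
    · rfl

/-- The block upper triangular, block Toeplitz matrix with the blocks `conjDiag f_d g_d`. -/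
def pairToeplitz (n : ℕ) (f g : PowerSeries ℂ) : Matrix (Fin n × Fin 2) (Fin n × Fin 2) ℂ :=
  toeplitz n f ⊗ₖ conjDiag 1 0 + toeplitz n g ⊗ₖ conjDiag 0 1

theorem conjDiag_mul (u v u' v' : ℂ) :
    conjDiag u v * conjDiag u' v' = conjDiag (u * u') (v * v') := by
  ext i j
  fin_cases i <;> fin_cases j <;> simp [conjDiag, Matrix.mul_apply] <;> field_simp <;>
    try simp only [Complex.I_sq]
  all_goals ring

theorem conjDiag_add (u v u' v' : ℂ) :
    conjDiag u v + conjDiag u' v' = conjDiag (u + u') (v + v') := by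
  ext i j
  fin_cases i <;> fin_cases j <;> simp [conjDiag] <;> ring

theorem conjDiag_smul (a u v : ℂ) : a • conjDiag u v = conjDiag (a * u) (a * v) := by
  ext i j
  fin_cases i <;> fin_cases j <;> simp [conjDiag] <;> ring

theorem conjDiag_one : conjDiag 1 1 = 1 := by
  ext i j
  fin_cases i <;> fin_cases j <;> simp [conjDiag]

theorem conjDiag_zero : conjDiag 0 0 = 0 := by
  ext i j
  fin_cases i <;> fin_cases j <;> simp [conjDiag]

theorem conjDiag_injective {u v u' v' : ℂ} (h : conjDiag u v = conjDiag u' v') :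
    u = u' ∧ v = v' := by
  have h0 := congrFun₂ h 0 0
  have h1 := congrFun₂ h 0 1
  simp only [conjDiag, Matrix.of_apply, Matrix.cons_val', Matrix.cons_val_zero,
    Matrix.cons_val_one] at h0 h1
  have hI : (2 * Complex.I) ≠ 0 := by simp
  rw [div_left_inj' two_ne_zero] at h0
  rw [div_left_inj' hI] at h1
  constructor
  · linear_combination (h0 + h1) / 2
  · linear_combination (h0 - h1) / 2

theorem conjDiag_matC (a b : ℝ) :
    conjDiag ⟨a, b⟩ (conj ⟨a, b⟩) = (matC a b).map Complex.ofReal := by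
  ext i j
  fin_cases i <;> fin_cases j <;> simp [conjDiag, matC, Complex.ext_iff, Complex.div_re,
    Complex.div_im, Complex.normSq] <;> ring

theorem pairToeplitz_apply (n : ℕ) (f g : PowerSeries ℂ) (x y : Fin n × Fin 2) :
    pairToeplitz n f g x y =
      if (x.1 : ℕ) ≤ (y.1 : ℕ) then
        conjDiag (PowerSeries.coeff ((y.1 : ℕ) - (x.1 : ℕ)) f)
          (PowerSeries.coeff ((y.1 : ℕ) - (x.1 : ℕ)) g) x.2 y.2
      else 0 := by
  have h (u v : ℂ) : conjDiag u v = u • conjDiag 1 0 + v • conjDiag 0 1 := by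
    simp [conjDiag_smul, conjDiag_add]
  rw [pairToeplitz, Matrix.add_apply, Matrix.kronecker_apply, Matrix.kronecker_apply]
  simp only [toeplitz_apply]
  split_ifs
  · rw [h (PowerSeries.coeff _ f)]; simp
  · simp

theorem pairToeplitz_add (n : ℕ) (f g f' g' : PowerSeries ℂ) :
    pairToeplitz n (f + f') (g + g') = pairToeplitz n f g + pairToeplitz n f' g' := by
  simp only [pairToeplitz, toeplitz_add, Matrix.add_kronecker]
  abel

/-- `conjDiag 1 0` and `conjDiag 0 1` are orthogonal idempotents, so the cross terms vanish. -/
theorem pairToeplitz_mul (n : ℕ) (f g f' g' : PowerSeries ℂ) :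
    pairToeplitz n (f * f') (g * g') = pairToeplitz n f g * pairToeplitz n f' g' := by
  simp [pairToeplitz, toeplitz_mul, mul_add, add_mul, ← Matrix.mul_kronecker_mul, conjDiag_mul,
    conjDiag_zero]

theorem pairToeplitz_C (n : ℕ) (a : ℂ) :
    pairToeplitz n (PowerSeries.C a) (PowerSeries.C a) = a • 1 := by
  rw [pairToeplitz, toeplitz_C, Matrix.smul_kronecker, Matrix.smul_kronecker, ← smul_add,
    ← Matrix.kronecker_add, conjDiag_add]
  simp [conjDiag_one]

theorem pairToeplitz_X_add_C (n : ℕ) (a b : ℝ) :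
    pairToeplitz n (PowerSeries.X + PowerSeries.C ⟨a, b⟩)
        (PowerSeries.X + PowerSeries.C (conj ⟨a, b⟩)) =
      (realJordanBlock n a b).map Complex.ofReal := by
  ext ⟨s, u⟩ ⟨t, v⟩
  simp only [pairToeplitz_apply, realJordanBlock, Matrix.map_apply, Matrix.of_apply, map_add,
    PowerSeries.coeff_X, PowerSeries.coeff_C, Fin.ext_iff]
  split_ifs <;> first
    | omega
    | (simp [conjDiag_matC]; done)
    | (simp [conjDiag_one, Matrix.one_apply, apply_ite Complex.ofReal]; done)
    | simp [conjDiag_zero]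

theorem pairToeplitz_sqrtSeries (n : ℕ) (a b : ℝ) (j : Fin 2 × Fin 2) :
    pairToeplitz n (sqrtSeries (branchAt j ⟨a, b⟩) ⟨a, b⟩)
        (sqrtSeries (branchAt j (conj ⟨a, b⟩)) (conj ⟨a, b⟩)) = blockF n a b j := by
  ext x y
  simp [pairToeplitz_apply, blockF, coeffF]

theorem pairToeplitz_eq_iff {n : ℕ} {f g f' g' : PowerSeries ℂ} :
    pairToeplitz n f g = pairToeplitz n f' g' ↔
      PowerSeries.X ^ n ∣ f - f' ∧ PowerSeries.X ^ n ∣ g - g' := by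
  constructor
  · intro h
    simp only [PowerSeries.X_pow_dvd_iff, map_sub, sub_eq_zero]
    rw [← forall₂_and]
    intro m hm
    apply conjDiag_injective
    ext u v
    have := congrFun₂ h (⟨0, by omega⟩, u) (⟨m, hm⟩, v)
    simpa [pairToeplitz_apply] using this
  · rintro ⟨h1, h2⟩
    rw [pairToeplitz, toeplitz_eq_iff.mpr h1, toeplitz_eq_iff.mpr h2, pairToeplitz]

/-! ### The algebra of block Toeplitz matrices of a real Jordan matrix -/

namespace RealJordan

variable (D : RealJordan)

theorem lam_ne_zero (k : Fin D.p) : D.lam k ≠ 0 := fun h =>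
  D.b_ne_zero k (congrArg Complex.im h)

theorem conj_lam_ne_zero (k : Fin D.p) : conj (D.lam k) ≠ 0 := by
  simpa using D.lam_ne_zero k

/-- Pairs of power series for the real Jordan blocks, and power series for the canonical Jordan
blocks with real eigenvalues. -/
abbrev Series : Type :=
  (Fin D.p → PowerSeries ℂ × PowerSeries ℂ) × (Fin D.q → PowerSeries ℂ)

/-- The block diagonal matrix of the (block) Toeplitz matrices of power series. -/
def blockToeplitz (F : D.Series) : Matrix D.Idx D.Idx ℂ :=
  D.blockDiag (fun k => pairToeplitz (D.m k) (F.1 k).1 (F.1 k).2)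
    (fun l => toeplitz (D.n l) (F.2 l))

theorem blockDiag_inj {R : Type} [Zero R]
    {F F' : ∀ k : Fin D.p, Matrix (Fin (D.m k) × Fin 2) (Fin (D.m k) × Fin 2) R}
    {L L' : ∀ l : Fin D.q, Matrix (Fin (D.n l)) (Fin (D.n l)) R} :
    D.blockDiag F L = D.blockDiag F' L' ↔ F = F' ∧ L = L' := by
  simp [blockDiag, Matrix.fromBlocks_inj, Matrix.blockDiagonal'_inj]

theorem blockDiag_map (F : ∀ k : Fin D.p, Matrix (Fin (D.m k) × Fin 2) (Fin (D.m k) × Fin 2) ℝ)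
    (L : ∀ l : Fin D.q, Matrix (Fin (D.n l)) (Fin (D.n l)) ℝ) :
    (D.blockDiag F L).map Complex.ofReal =
      D.blockDiag (fun k => (F k).map Complex.ofReal) (fun l => (L l).map Complex.ofReal) := by
  simp [blockDiag, Matrix.fromBlocks_map, Matrix.blockDiagonal'_map]

/-- Reduces entrywise conditions to the diagonal blocks; `q 0` covers the entries outside them. It
is applied with vanishing imaginary part and with vanishing real part. -/
theorem forall_blockDiag {F : ∀ k : Fin D.p, Matrix (Fin (D.m k) × Fin 2) (Fin (D.m k) × Fin 2) ℂ}
    {L : ∀ l : Fin D.q, Matrix (Fin (D.n l)) (Fin (D.n l)) ℂ} {q : ℂ → Prop} (hq : q 0) :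
    (∀ x y, q (D.blockDiag F L x y)) ↔
      (∀ k x y, q (F k x y)) ∧ ∀ l x y, q (L l x y) := by
  constructor
  · intro h
    constructor
    · intro k x y
      simpa [blockDiag] using h (.inl ⟨k, x⟩) (.inl ⟨k, y⟩)
    · intro l x y
      simpa [blockDiag] using h (.inr ⟨l, x⟩) (.inr ⟨l, y⟩)
  · rintro ⟨h1, h2⟩ (⟨k, x⟩ | ⟨k, x⟩) (⟨l, y⟩ | ⟨l, y⟩)
    · by_cases hkl : k = l
      · subst hkl
        simpa [blockDiag] using h1 k x y
      · simpa [blockDiag, Matrix.blockDiagonal'_apply_ne _ _ _ hkl] using hq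
    · simpa [blockDiag] using hq
    · simpa [blockDiag] using hq
    · by_cases hkl : k = l
      · subst hkl
        simpa [blockDiag] using h2 k x y
      · simpa [blockDiag, Matrix.blockDiagonal'_apply_ne _ _ _ hkl] using hq

theorem blockToeplitz_add (F G : D.Series) :
    D.blockToeplitz (F + G) = D.blockToeplitz F + D.blockToeplitz G := by
  simp only [blockToeplitz, blockDiag, Matrix.fromBlocks_add, Prod.fst_add, Prod.snd_add,
    Pi.add_apply, pairToeplitz_add, toeplitz_add, add_zero]
  congr 1
  · exact Matrix.blockDiagonal'_add _ _
  · exact Matrix.blockDiagonal'_add _ _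

theorem blockToeplitz_mul (F G : D.Series) :
    D.blockToeplitz (F * G) = D.blockToeplitz F * D.blockToeplitz G := by
  simp only [blockToeplitz, blockDiag, Matrix.fromBlocks_multiply, Prod.fst_mul, Prod.snd_mul,
    Pi.mul_apply, pairToeplitz_mul, toeplitz_mul, add_zero, Matrix.mul_zero, Matrix.zero_mul,
    zero_add]
  congr 1
  · exact Matrix.blockDiagonal'_mul _ _
  · exact Matrix.blockDiagonal'_mul _ _

theorem blockToeplitz_algebraMap (a : ℂ) :
    D.blockToeplitz (algebraMap ℂ D.Series a) = algebraMap ℂ _ a := by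
  have h1 : (fun k : Fin D.p => a • (1 : Matrix (Fin (D.m k) × Fin 2) (Fin (D.m k) × Fin 2) ℂ)) =
    a • 1 := rfl
  have h2 : (fun k : Fin D.q => a • (1 : Matrix (Fin (D.n k)) (Fin (D.n k)) ℂ)) =
    a • 1 := rfl
  have : D.blockToeplitz (algebraMap ℂ D.Series a) = D.blockDiag (fun k => a • 1)
      (fun l => a • 1) := by
    simp only [blockToeplitz, ← pairToeplitz_C, ← toeplitz_C]
    rfl
  rw [this, blockDiag, h1, h2, Matrix.blockDiagonal'_smul, Matrix.blockDiagonal'_smul,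
    Matrix.blockDiagonal'_one, Matrix.blockDiagonal'_one, Algebra.algebraMap_eq_smul_one,
    ← Matrix.fromBlocks_one, Matrix.fromBlocks_smul, smul_zero, smul_zero]

/-- `blockToeplitz` as a homomorphism of algebras. -/
def blockToeplitzHom : D.Series →ₐ[ℂ] Matrix D.Idx D.Idx ℂ where
  toFun := D.blockToeplitz
  map_one' := by
    rw [← map_one (algebraMap ℂ D.Series), D.blockToeplitz_algebraMap, map_one]
  map_mul' := D.blockToeplitz_mul
  map_zero' := by
    rw [← map_zero (algebraMap ℂ D.Series), D.blockToeplitz_algebraMap, map_zero]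
  map_add' := D.blockToeplitz_add
  commutes' := D.blockToeplitz_algebraMap

theorem blockToeplitz_eq_iff {F G : D.Series} :
    D.blockToeplitz F = D.blockToeplitz G ↔
      (∀ k, PowerSeries.X ^ D.m k ∣ (F.1 k).1 - (G.1 k).1 ∧
        PowerSeries.X ^ D.m k ∣ (F.1 k).2 - (G.1 k).2) ∧
      ∀ l, PowerSeries.X ^ D.n l ∣ F.2 l - G.2 l := by
  rw [blockToeplitz, blockToeplitz, blockDiag_inj, funext_iff, funext_iff]
  simp only [pairToeplitz_eq_iff, toeplitz_eq_iff]

/-- The shifted variables `X + μ`, whose block Toeplitz matrix is the Jordan matrix. -/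
def shift : D.Series :=
  (fun k => (PowerSeries.X + PowerSeries.C (D.lam k),
    PowerSeries.X + PowerSeries.C (conj (D.lam k))),
    fun l => PowerSeries.X + PowerSeries.C (D.x l : ℂ))

theorem blockToeplitz_shift : D.blockToeplitz D.shift = D.toComplex := by
  rw [toComplex, toMatrix, blockDiag_map, blockToeplitz, blockDiag_inj]
  exact ⟨funext fun k => pairToeplitz_X_add_C _ _ _, funext fun l => toeplitz_X_add_C _ _⟩

/-- The Taylor expansions of a polynomial at all eigenvalues. -/
def taylor (P : Polynomial ℂ) : D.Series :=
  (fun k => (taylorSeries (D.lam k) P, taylorSeries (conj (D.lam k)) P),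
    fun l => taylorSeries (D.x l) P)

/-- Polynomial evaluation commutes with algebra homomorphisms: first with `blockToeplitzHom`, then
with the projection to each factor. -/
theorem aeval_toComplex (P : Polynomial ℂ) :
    Polynomial.aeval D.toComplex P = D.blockToeplitz (D.taylor P) := by
  have h1 : D.toComplex = D.blockToeplitzHom D.shift := D.blockToeplitz_shift.symm
  rw [h1, Polynomial.aeval_algHom_apply]
  change D.blockToeplitz _ = _
  congr 1
  refine Prod.ext (funext fun k => Prod.ext ?_ ?_) (funext fun l => ?_)
  · exact (Polynomial.aeval_algHom_apply ((AlgHom.fst ℂ _ _).comp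
      ((Pi.evalAlgHom ℂ _ k).comp (AlgHom.fst ℂ _ _))) D.shift P).symm
  · exact (Polynomial.aeval_algHom_apply ((AlgHom.snd ℂ _ _).comp
      ((Pi.evalAlgHom ℂ _ k).comp (AlgHom.fst ℂ _ _))) D.shift P).symm
  · exact (Polynomial.aeval_algHom_apply
      ((Pi.evalAlgHom ℂ _ l).comp (AlgHom.snd ℂ _ _)) D.shift P).symm

/-- The Taylor series of the branches of the square root with the given labels. -/
def sqrtLabels (j : Fin D.p → Fin 2 × Fin 2) (i : Fin D.q → Fin 2) : D.Series :=
  (fun k => (sqrtSeries (branchAt (j k) (D.lam k)) (D.lam k),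
    sqrtSeries (branchAt (j k) (conj (D.lam k))) (conj (D.lam k))),
    fun l => sqrtSeries (i l) (D.x l))

theorem blockToeplitz_sqrtLabels (j : Fin D.p → Fin 2 × Fin 2) (i : Fin D.q → Fin 2) :
    D.blockToeplitz (D.sqrtLabels j i) = D.blockSqrt j i := by
  rw [blockToeplitz, blockSqrt, blockDiag_inj]
  exact ⟨funext fun k => pairToeplitz_sqrtSeries _ _ _ _, funext fun l => toeplitz_sqrtSeries _ _ _⟩

end RealJordan

namespace RealJordan

variable (D : RealJordan)

/-! ### The square roots which are functions of the Jordan matrix -/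

theorem blockSqrt_mul_self (hx : ∀ l, D.x l ≠ 0) (j : Fin D.p → Fin 2 × Fin 2)
    (i : Fin D.q → Fin 2) : D.blockSqrt j i * D.blockSqrt j i = D.toComplex := by
  rw [← blockToeplitz_sqrtLabels, ← blockToeplitz_mul, ← blockToeplitz_shift]
  congr 1
  refine Prod.ext (funext fun k => Prod.ext ?_ ?_) (funext fun l => ?_)
  · exact sqrtSeries_mul_self _ (D.lam_ne_zero k)
  · exact sqrtSeries_mul_self _ (D.conj_lam_ne_zero k)
  · exact sqrtSeries_mul_self _ (Complex.ofReal_ne_zero.mpr (hx l))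

theorem branchAt_congr_of_lam {j : Fin D.p → Fin 2 × Fin 2} {i : Fin D.q → Fin 2}
    (h : D.Admissible j i) {k l : Fin D.p} {μ : ℂ} (hk : D.lam k = μ ∨ conj (D.lam k) = μ)
    (hl : D.lam l = μ ∨ conj (D.lam l) = μ) : j k = j l := by
  refine h.1 k l ?_
  rcases hk with rfl | rfl <;> rcases hl with hl | hl
  · exact .inl hl.symm
  · exact .inr hl.symm
  · exact .inr (by rw [hl, Complex.conj_conj])
  · exact .inl ((starRingEnd ℂ).injective hl.symm)

/-- Admissible labels come from a choice of a branch at each eigenvalue. -/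
theorem Admissible.exists_branch {D : RealJordan} {j : Fin D.p → Fin 2 × Fin 2}
    {i : Fin D.q → Fin 2} (h : D.Admissible j i) :
    ∃ B : ℂ → Fin 2, (∀ k, B (D.lam k) = branchAt (j k) (D.lam k) ∧
      B (conj (D.lam k)) = branchAt (j k) (conj (D.lam k))) ∧ ∀ l, B (D.x l) = i l := by
  classical
  let B : ℂ → Fin 2 := fun μ =>
    if h : ∃ k, D.lam k = μ ∨ conj (D.lam k) = μ then branchAt (j h.choose) μ
    else if h : ∃ l, (D.x l : ℂ) = μ then i h.choose else 0
  have hB (k : Fin D.p) (μ : ℂ) (hk : D.lam k = μ ∨ conj (D.lam k) = μ) :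
      B μ = branchAt (j k) μ := by
    have hex : ∃ k, D.lam k = μ ∨ conj (D.lam k) = μ := ⟨k, hk⟩
    simp only [B, dif_pos hex]
    rw [D.branchAt_congr_of_lam h hex.choose_spec hk]
  refine ⟨B, fun k => ⟨hB k _ (.inl rfl), hB k _ (.inr rfl)⟩, fun l => ?_⟩
  -- A real eigenvalue is never one of the nonreal ones, so the definition of `B` reaches its second
  -- case; the value `0` is used only away from the spectrum.
  have hn : ¬ ∃ k, D.lam k = (D.x l : ℂ) ∨ conj (D.lam k) = (D.x l : ℂ) := by
    rintro ⟨k, hk⟩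
    apply D.b_ne_zero k
    rcases hk with hk | hk <;> simpa [lam] using congrArg Complex.im hk
  have hex : ∃ l', (D.x l' : ℂ) = (D.x l : ℂ) := ⟨l, rfl⟩
  simp only [B, dif_neg hn, dif_pos hex]
  exact h.2 _ _ (Complex.ofReal_injective hex.choose_spec)

/-- A choice of a branch at each complex number gives admissible labels. -/
theorem exists_admissible (B : ℂ → Fin 2) :
    ∃ (j : Fin D.p → Fin 2 × Fin 2) (i : Fin D.q → Fin 2), D.Admissible j i ∧
      (∀ k, branchAt (j k) (D.lam k) = B (D.lam k) ∧
        branchAt (j k) (conj (D.lam k)) = B (conj (D.lam k))) ∧ ∀ l, i l = B (D.x l) := by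
  -- Using `|b|` puts the upper half-plane point first whatever the sign of `b`, so blocks with the
  -- same conjugate pair receive the same label.
  refine ⟨fun k => (B ⟨D.a k, |D.b k|⟩, B ⟨D.a k, -|D.b k|⟩), fun l => B (D.x l),
    ⟨fun k l h => ?_, fun k l h => by simp only [h]⟩, fun k => ?_, fun _ => rfl⟩
  · have h1 : D.a k = D.a l := by
      rcases h with h | h <;> simpa [lam] using congrArg Complex.re h
    have h2 : |D.b k| = |D.b l| := by
      rw [abs_eq_abs]
      exact h.imp (fun h => congrArg Complex.im h) (fun h => congrArg Complex.im h)
    simp only [h1, h2]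
  · rcases (D.b_ne_zero k).lt_or_gt with hb | hb
    · have h1 : D.lam k = ⟨D.a k, -|D.b k|⟩ := by simp [lam, abs_of_neg hb]
      have h2 : conj (D.lam k) = ⟨D.a k, |D.b k|⟩ := by simp [lam, abs_of_neg hb, Complex.ext_iff]
      dsimp only
      rw [← h1, ← h2]
      simp [branchAt, lam, hb, hb.not_gt]
    · have h1 : D.lam k = ⟨D.a k, |D.b k|⟩ := by simp [lam, abs_of_pos hb]
      have h2 : conj (D.lam k) = ⟨D.a k, -|D.b k|⟩ := by simp [lam, abs_of_pos hb, Complex.ext_iff]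
      dsimp only
      rw [← h1, ← h2]
      simp [branchAt, lam, hb, hb.le]

theorem exists_aeval_eq_blockSqrt {j : Fin D.p → Fin 2 × Fin 2} {i : Fin D.q → Fin 2}
    (h : D.Admissible j i) :
    ∃ P : Polynomial ℂ, D.blockSqrt j i = Polynomial.aeval D.toComplex P := by
  classical
  obtain ⟨B, hB, hBx⟩ := h.exists_branch
  -- The sum of all block sizes serves as one interpolation order that is sufficient for every
  -- block.
  obtain ⟨P, hP⟩ := exists_taylorSeries_sub_dvd
    (Finset.univ.image D.lam ∪ Finset.univ.image (fun k => conj (D.lam k)) ∪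
      Finset.univ.image fun l => (D.x l : ℂ)) (∑ k, D.m k + ∑ l, D.n l)
    fun μ => sqrtSeries (B μ) μ
  have hm (k : Fin D.p) : D.m k ≤ ∑ k, D.m k + ∑ l, D.n l :=
    (Finset.single_le_sum (fun _ _ => Nat.zero_le _) (Finset.mem_univ k)).trans
      (Nat.le_add_right _ _)
  have hn (l : Fin D.q) : D.n l ≤ ∑ k, D.m k + ∑ l, D.n l :=
    (Finset.single_le_sum (fun _ _ => Nat.zero_le _) (Finset.mem_univ l)).trans
      (Nat.le_add_left _ _)
  refine ⟨P, ?_⟩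
  rw [aeval_toComplex, ← blockToeplitz_sqrtLabels, eq_comm, blockToeplitz_eq_iff]
  refine ⟨fun k => ⟨?_, ?_⟩, fun l => ?_⟩
  · refine (pow_dvd_pow _ (hm k)).trans ?_
    have := hP (D.lam k) (by simp)
    rwa [(hB k).1] at this
  · refine (pow_dvd_pow _ (hm k)).trans ?_
    have := hP (conj (D.lam k)) (by simp)
    rwa [(hB k).2] at this
  · refine (pow_dvd_pow _ (hn l)).trans ?_
    have := hP (D.x l) (by simp)
    rwa [hBx l] at this

theorem eval_mul_eval_of_dvd {n : ℕ} (hn : 0 < n) {μ : ℂ} {P : Polynomial ℂ}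
    (h : PowerSeries.X ^ n ∣
      taylorSeries μ P * taylorSeries μ P - (PowerSeries.X + PowerSeries.C μ)) :
    P.eval μ * P.eval μ = μ := by
  rw [PowerSeries.X_pow_dvd_iff] at h
  simpa [constantCoeff_taylorSeries, sub_eq_zero] using h 0 hn

/-- The square roots of a nonsingular real Jordan matrix which are functions of it. -/
theorem mem_sqrtFunctions_toComplex_iff (hx : ∀ l, D.x l ≠ 0) (X : Matrix D.Idx D.Idx ℂ) :
    X ∈ sqrtFunctions D.toComplex ↔ ∃ j i, D.Admissible j i ∧ X = D.blockSqrt j i := by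
  rw [mem_sqrtFunctions_iff]
  constructor
  · rintro ⟨hX, P, rfl⟩
    rw [aeval_toComplex, ← blockToeplitz_mul, ← blockToeplitz_shift, blockToeplitz_eq_iff] at hX
    obtain ⟨h1, h2⟩ := hX
    -- The branch is read off from `P.eval μ` alone, so blocks sharing an eigenvalue get the same
    -- branch; elsewhere its value is immaterial.
    have hB : ∀ μ : ℂ, ∃ b : Fin 2, μ ≠ 0 → P.eval μ * P.eval μ = μ →
        P.eval μ = sqrtCoeff b μ 0 := fun μ => by
      by_cases h : μ ≠ 0 ∧ P.eval μ * P.eval μ = μ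
      · obtain ⟨b, hb⟩ := exists_eq_sqrtCoeff_zero h.1 h.2
        exact ⟨b, fun _ _ => hb⟩
      · exact ⟨0, fun h0 h1 => absurd ⟨h0, h1⟩ h⟩
    choose B hB using hB
    have key {n : ℕ} (hn : 0 < n) {μ : ℂ} (hμ : μ ≠ 0) (h : PowerSeries.X ^ n ∣
        taylorSeries μ P * taylorSeries μ P - (PowerSeries.X + PowerSeries.C μ)) :
        PowerSeries.X ^ n ∣ taylorSeries μ P - sqrtSeries (B μ) μ :=
      X_pow_dvd_sub_sqrtSeries hμ h (by
        rw [constantCoeff_taylorSeries]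
        exact hB μ hμ (eval_mul_eval_of_dvd hn h))
    obtain ⟨j, i, hadm, hj, hi⟩ := D.exists_admissible B
    refine ⟨j, i, hadm, ?_⟩
    rw [aeval_toComplex, ← blockToeplitz_sqrtLabels, blockToeplitz_eq_iff]
    refine ⟨fun k => ⟨?_, ?_⟩, fun l => ?_⟩
    · simp only [sqrtLabels, (hj k).1]
      exact key (D.m_pos k) (D.lam_ne_zero k) (h1 k).1
    · simp only [sqrtLabels, (hj k).2]
      exact key (D.m_pos k) (D.conj_lam_ne_zero k) (h1 k).2
    · simp only [sqrtLabels, hi]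
      exact key (D.n_pos l) (Complex.ofReal_ne_zero.mpr (hx l)) (h2 l)
  · rintro ⟨j, i, hadm, rfl⟩
    exact ⟨D.blockSqrt_mul_self hx j i, D.exists_aeval_eq_blockSqrt hadm⟩

/-- Blocks are nonempty, so their diagonals display the constant terms, and the two square roots of
a nonzero number differ. -/
theorem blockSqrt_injective (hx : ∀ l, D.x l ≠ 0) {j j' : Fin D.p → Fin 2 × Fin 2}
    {i i' : Fin D.q → Fin 2} (h : D.blockSqrt j i = D.blockSqrt j' i') : j = j' ∧ i = i' := by
  rw [← blockToeplitz_sqrtLabels, ← blockToeplitz_sqrtLabels, blockToeplitz_eq_iff] at h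
  have key {n : ℕ} (hn : 0 < n) {μ : ℂ} (hμ : μ ≠ 0) {b b' : Fin 2}
      (h : PowerSeries.X ^ n ∣ sqrtSeries b μ - sqrtSeries b' μ) : b = b' := by
    rw [PowerSeries.X_pow_dvd_iff] at h
    apply sqrtCoeff_zero_injective hμ
    have := h 0 hn
    rw [map_sub, sub_eq_zero] at this
    simpa only [coeff_sqrtSeries] using this
  constructor
  · funext k
    have h1 := key (D.m_pos k) (D.lam_ne_zero k) (h.1 k).1
    have h2 := key (D.m_pos k) (D.conj_lam_ne_zero k) (h.1 k).2
    -- The sign of `b` decides which component of the label is used at `λ` and which at its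
    -- conjugate.
    rcases (D.b_ne_zero k).lt_or_gt with hb | hb <;>
      simp [branchAt, lam, hb, hb.not_gt] at h1 h2 <;>
      exact Prod.ext (by assumption) (by assumption)
  · funext l
    exact key (D.n_pos l) (Complex.ofReal_ne_zero.mpr (hx l)) (h.2 l)

/-! ### Real and pure imaginary blocks -/

theorem isRealMatrix_blockSqrt {j : Fin D.p → Fin 2 × Fin 2} {i : Fin D.q → Fin 2} :
    IsRealMatrix (D.blockSqrt j i) ↔
      (∀ k, IsRealMatrix (blockF (D.m k) (D.a k) (D.b k) (j k))) ∧
        ∀ l, IsRealMatrix (blockL (D.n l) (D.x l) (i l)) :=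
  D.forall_blockDiag (q := fun z => z.im = 0) rfl

theorem isPureImaginaryMatrix_blockSqrt {j : Fin D.p → Fin 2 × Fin 2} {i : Fin D.q → Fin 2} :
    IsPureImaginaryMatrix (D.blockSqrt j i) ↔
      (∀ k, IsPureImaginaryMatrix (blockF (D.m k) (D.a k) (D.b k) (j k))) ∧
        ∀ l, IsPureImaginaryMatrix (blockL (D.n l) (D.x l) (i l)) :=
  D.forall_blockDiag (q := fun z => z.re = 0) rfl

end RealJordan

theorem isRealMatrix_blockL {x : ℝ} (hx : 0 < x) (n : ℕ) (j : Fin 2) :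
    IsRealMatrix (blockL n x j) := by
  intro s t
  simp only [blockL, Matrix.of_apply]
  split_ifs
  · exact sqrtCoeff_ofReal_im j hx _
  · rfl

theorem isPureImaginaryMatrix_blockL {x : ℝ} (hx : x < 0) (n : ℕ) (j : Fin 2) :
    IsPureImaginaryMatrix (blockL n x j) := by
  intro s t
  simp only [blockL, Matrix.of_apply]
  split_ifs
  · exact sqrtCoeff_ofReal_re j hx _
  · rfl

theorem not_isRealMatrix_blockL {x : ℝ} (hx : x < 0) {n : ℕ} (hn : 0 < n) (j : Fin 2) :
    ¬ IsRealMatrix (blockL n x j) := by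
  intro h
  have him : (sqrtCoeff j (x : ℂ) 0).im = 0 := by simpa [blockL] using h ⟨0, hn⟩ ⟨0, hn⟩
  exact sqrtCoeff_zero_ne_zero j (Complex.ofReal_ne_zero.mpr hx.ne)
    (Complex.ext (sqrtCoeff_ofReal_re j hx 0) him)

/-- The entries are, up to sign, `(u + v) / 2` and `(u - v) / (2i)`; for `v = conj u` these are the
real and imaginary parts of `u`. -/
theorem conjDiag_isRealMatrix_iff {u v : ℂ} : IsRealMatrix (conjDiag u v) ↔ v = conj u := by
  simp only [IsRealMatrix, Fin.forall_fin_two, conjDiag, Complex.ext_iff]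
  simp [Complex.div_im, Complex.normSq]
  constructor
  · rintro h; constructor <;> linarith [h.1.1, h.1.2]
  · rintro ⟨h1, h2⟩; simp [h1, h2]

theorem conjDiag_isPureImaginaryMatrix_iff {u v : ℂ} :
    IsPureImaginaryMatrix (conjDiag u v) ↔ v = -conj u := by
  simp only [IsPureImaginaryMatrix, Fin.forall_fin_two, conjDiag, Complex.ext_iff]
  simp [Complex.div_re, Complex.normSq]
  constructor
  · rintro h; constructor <;> linarith [h.1.1, h.1.2]
  · rintro ⟨h1, h2⟩; simp [h1, h2]

theorem arg_ne_pi_of_im_ne_zero {a b : ℝ} (hb : b ≠ 0) : Complex.arg ⟨a, b⟩ ≠ Real.pi := by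
  intro h
  exact hb (Complex.arg_eq_pi_iff.mp h).2

theorem mk_ne_zero_of_im {a b : ℝ} (hb : b ≠ 0) : (⟨a, b⟩ : ℂ) ≠ 0 := fun h =>
  hb (congrArg Complex.im h)

theorem forall_coeffF_of_forall_blockF {n : ℕ} {a b : ℝ} {j : Fin 2 × Fin 2}
    {q : ℂ → Prop} (hn : 0 < n) (h : ∀ x y, q (blockF n a b j x y)) (u v : Fin 2) :
    q (coeffF a b j 0 u v) := by
  simpa [blockF] using h (⟨0, hn⟩, u) (⟨0, hn⟩, v)

theorem forall_blockF_of_forall_coeffF {n : ℕ} {a b : ℝ} {j : Fin 2 × Fin 2}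
    {q : ℂ → Prop} (h0 : q 0) (h : ∀ d u v, q (coeffF a b j d u v)) (x y : Fin n × Fin 2) :
    q (blockF n a b j x y) := by
  simp only [blockF, Matrix.of_apply]
  split_ifs
  · exact h _ _ _
  · exact h0

/-- Expresses both diagonal parameters through branches at the same point `a + ib`, so that reality
becomes equality of two branch numbers. -/
theorem coeffF_eq {a b : ℝ} (hb : b ≠ 0) (j : Fin 2 × Fin 2) (d : ℕ) :
    coeffF a b j d = conjDiag (sqrtCoeff (branchAt j ⟨a, b⟩) ⟨a, b⟩ d)
      (conj (sqrtCoeff (branchAt j (conj ⟨a, b⟩)) ⟨a, b⟩ d)) := by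
  rw [conj_sqrtCoeff _ (mk_ne_zero_of_im hb) (arg_ne_pi_of_im_ne_zero hb)]
  rfl

theorem branchAt_eq_iff {a b : ℝ} (hb : b ≠ 0) (j : Fin 2 × Fin 2) :
    branchAt j ⟨a, b⟩ = branchAt j (conj ⟨a, b⟩) ↔ j.2 = j.1 := by
  rcases hb.lt_or_gt with hb | hb
  · simp [branchAt, hb, hb.not_gt]
  · simp [branchAt, hb, hb.not_gt, eq_comm]

/-- The diagonal block already forces equal branches, and equal branches make the coefficients of
every order conjugate. -/
theorem isRealMatrix_blockF_iff {n : ℕ} {a b : ℝ} {j : Fin 2 × Fin 2} (hn : 0 < n)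
    (hb : b ≠ 0) : IsRealMatrix (blockF n a b j) ↔ j.2 = j.1 := by
  rw [← branchAt_eq_iff (a := a) hb]
  constructor
  · intro h
    have h0 : IsRealMatrix (coeffF a b j 0) :=
      forall_coeffF_of_forall_blockF (q := fun z => z.im = 0) hn h
    rw [coeffF_eq hb, conjDiag_isRealMatrix_iff] at h0
    exact (sqrtCoeff_zero_injective (mk_ne_zero_of_im hb) ((starRingEnd ℂ).injective h0)).symm
  · intro h
    refine forall_blockF_of_forall_coeffF (q := fun z => z.im = 0) rfl fun d => ?_
    change IsRealMatrix (coeffF a b j d)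
    rw [coeffF_eq hb, conjDiag_isRealMatrix_iff, h]

theorem sqrtCoeff_rev (j : Fin 2) (μ : ℂ) (d : ℕ) :
    sqrtCoeff j.rev μ d = -sqrtCoeff j μ d := by
  fin_cases j
  · exact sqrtCoeff_one μ d
  · simp [sqrtCoeff_one]

theorem isPureImaginaryMatrix_blockF_iff {n : ℕ} {a b : ℝ} {j : Fin 2 × Fin 2} (hn : 0 < n)
    (hb : b ≠ 0) : IsPureImaginaryMatrix (blockF n a b j) ↔ j.2 = j.1.rev := by
  -- With only two branch numbers, the opposite one is the same as a different one.
  have hj : j.2 = j.1.rev ↔ ¬ j.2 = j.1 := by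
    rcases j with ⟨s, t⟩
    fin_cases s <;> fin_cases t <;> simp
  have hr (s t : Fin 2) : ¬ s = t ↔ t = s.rev := by
    fin_cases s <;> fin_cases t <;> simp
  rw [hj, ← branchAt_eq_iff (a := a) hb, hr]
  constructor
  · intro h
    have h0 : IsPureImaginaryMatrix (coeffF a b j 0) :=
      forall_coeffF_of_forall_blockF (q := fun z => z.re = 0) hn h
    rw [coeffF_eq hb, conjDiag_isPureImaginaryMatrix_iff, ← map_neg, ← sqrtCoeff_rev] at h0
    exact sqrtCoeff_zero_injective (mk_ne_zero_of_im hb) ((starRingEnd ℂ).injective h0)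
  · intro h
    refine forall_blockF_of_forall_coeffF (q := fun z => z.re = 0) rfl fun d => ?_
    change IsPureImaginaryMatrix (coeffF a b j d)
    rw [coeffF_eq hb, conjDiag_isPureImaginaryMatrix_iff, h, sqrtCoeff_rev, map_neg]

namespace RealJordan

variable (D : RealJordan)

/-! ### Real eigenvalues -/

/-- The first basis vector of a canonical block is an eigenvector. This shows both that each `D.x l`
is an eigenvalue and that nonsingularity excludes `D.x l = 0`. -/
theorem toMatrix_mulVec_single (l : Fin D.q) :
    D.toMatrix.mulVec (Pi.single (.inr ⟨l, ⟨0, D.n_pos l⟩⟩) 1) =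
      D.x l • Pi.single (.inr ⟨l, ⟨0, D.n_pos l⟩⟩) 1 := by
  rw [Matrix.mulVec_single_one]
  funext y
  rcases y with ⟨k, y⟩ | ⟨k, y⟩
  · simp [toMatrix, blockDiag, Matrix.col]
  · by_cases hkl : k = l
    · subst hkl
      simp only [toMatrix, blockDiag, Matrix.col, Matrix.transpose_apply,
        Matrix.fromBlocks_apply₂₂, Matrix.blockDiagonal'_apply_eq, jordanBlockReal, Matrix.of_apply]
      by_cases hy : y = ⟨0, D.n_pos k⟩
      · simp [hy]
      · simp [hy]
    · simp [toMatrix, blockDiag, Matrix.col, Matrix.blockDiagonal'_apply_ne _ _ _ hkl, hkl]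

theorem isEigenvalue_x (l : Fin D.q) : IsEigenvalue D.toMatrix (D.x l) := by
  refine Module.End.hasEigenvalue_of_hasEigenvector
    (x := Pi.single (.inr ⟨l, ⟨0, D.n_pos l⟩⟩) 1) ⟨?_, ?_⟩
  · rw [Module.End.mem_eigenspace_iff, Matrix.toLin'_apply, toMatrix_mulVec_single]
  · simp

theorem x_ne_zero_of_isUnit_det (hD : IsUnit D.toMatrix.det) (l : Fin D.q) : D.x l ≠ 0 := by
  intro h
  have h1 := D.toMatrix_mulVec_single l
  rw [h, zero_smul] at h1
  have := Matrix.eq_zero_of_mulVec_eq_zero hD.ne_zero h1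
  simp at this

/-- If the real `t` differs from every `D.x l`, it differs from all `μ` in `shift`, the remaining
ones being nonreal. Then `shift - t` has nonzero constant terms, so it is a unit, and its image `J_R
- t` is invertible. -/
theorem exists_x_eq_of_isEigenvalue {t : ℝ} (ht : IsEigenvalue D.toMatrix t) :
    ∃ l, D.x l = t := by
  by_contra! hne
  have hu : IsUnit (D.shift - algebraMap ℂ D.Series t) := by
    have hs {μ : ℂ} (h : μ ≠ t) :
        IsUnit (PowerSeries.X + PowerSeries.C μ - algebraMap ℂ (PowerSeries ℂ) t) := by
      rw [PowerSeries.isUnit_iff_constantCoeff, PowerSeries.algebraMap_apply]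
      simpa [sub_eq_zero] using h
    rw [Prod.isUnit_iff, Pi.isUnit_iff, Pi.isUnit_iff]
    refine ⟨fun k => Prod.isUnit_iff.mpr ⟨hs fun h => D.b_ne_zero k ?_,
      hs fun h => D.b_ne_zero k ?_⟩, fun l => hs fun h => hne l (Complex.ofReal_injective h)⟩
    · simpa [lam] using congrArg Complex.im h
    · simpa [lam] using congrArg Complex.im h
  have h1 := hu.map D.blockToeplitzHom
  rw [map_sub, AlgHom.commutes] at h1
  have h2 : D.blockToeplitzHom D.shift = D.toComplex := D.blockToeplitz_shift
  rw [h2] at h1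
  have h3 : D.toComplex - algebraMap ℂ _ (t : ℂ) =
      (D.toMatrix - algebraMap ℝ _ t).map Complex.ofReal := by
    ext x y
    by_cases hxy : x = y <;> simp [toComplex, Matrix.algebraMap_matrix_apply, hxy]
  rw [h3, Matrix.isUnit_iff_isUnit_det] at h1
  have h4 : ((D.toMatrix - algebraMap ℝ _ t).map Complex.ofReal).det =
      ((D.toMatrix - algebraMap ℝ _ t).det : ℂ) :=
    (Complex.ofRealHom.map_det _).symm
  rw [h4] at h1
  have h5 : (D.toMatrix - algebraMap ℝ _ t).det ≠ 0 := fun h => by simp [h] at h1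
  obtain ⟨v, hv⟩ := Module.End.HasEigenvalue.exists_hasEigenvector ht
  apply hv.2
  apply Matrix.eq_zero_of_mulVec_eq_zero h5
  have := hv.apply_eq_smul
  rw [Matrix.toLin'_apply] at this
  rw [Matrix.sub_mulVec, this, Algebra.algebraMap_eq_smul_one, Matrix.smul_mulVec,
    Matrix.one_mulVec, sub_self]

/-! ### Counting -/

/-- The unordered pair of conjugate eigenvalues of the `k`-th real Jordan block. -/
abbrev conjPair (k : Fin D.p) : Sym2 ℂ := s(D.lam k, conj (D.lam k))

theorem conjPair_eq_iff (k l : Fin D.p) :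
    D.conjPair k = D.conjPair l ↔ D.lam k = D.lam l ∨ D.lam k = conj (D.lam l) := by
  rw [conjPair, conjPair, Sym2.eq_iff]
  constructor
  · rintro (h | h)
    · exact .inl h.1
    · exact .inr h.1
  · rintro (h | h)
    · exact .inl ⟨h, by rw [h]⟩
    · exact .inr ⟨h, by rw [h, Complex.conj_conj]⟩

/-- The labels at the distinct eigenvalues determine the square root, if the branch in the lower
half-plane is a function of the branch in the upper half-plane. -/
def ofLabels (σ : Fin 2 → Fin 2)
    (u : (Set.range D.conjPair → Fin 2) × (Set.range D.x → Fin 2)) : Matrix D.Idx D.Idx ℂ :=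
  D.blockSqrt (fun k => (u.1 ⟨D.conjPair k, k, rfl⟩, σ (u.1 ⟨D.conjPair k, k, rfl⟩)))
    (fun l => u.2 ⟨D.x l, l, rfl⟩)

theorem ofLabels_injective (hx : ∀ l, D.x l ≠ 0) (σ : Fin 2 → Fin 2) :
    Function.Injective (D.ofLabels σ) := by
  intro u v h
  obtain ⟨h1, h2⟩ := D.blockSqrt_injective hx h
  refine Prod.ext (funext ?_) (funext ?_)
  · rintro ⟨_, k, rfl⟩
    exact congrArg Prod.fst (congrFun h1 k)
  · rintro ⟨_, l, rfl⟩
    exact congrFun h2 l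

theorem range_ofLabels (σ : Fin 2 → Fin 2) :
    Set.range (D.ofLabels σ) = {X | ∃ j i, D.Admissible j i ∧ (∀ k, (j k).2 = σ (j k).1) ∧
      X = D.blockSqrt j i} := by
  ext X
  constructor
  · rintro ⟨u, rfl⟩
    refine ⟨_, _, ⟨fun k l h => ?_, fun k l h => ?_⟩, fun k => rfl, rfl⟩
    · rw [← conjPair_eq_iff] at h
      simp only [h]
    · simp only [h]
  · rintro ⟨j, i, ⟨hj, hi⟩, hσ, rfl⟩
    -- Admissibility makes the label independent of the block chosen to represent an eigenvalue.
    refine ⟨(fun s => (j s.2.choose).1, fun s => i s.2.choose), ?_⟩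
    have h1 (k : Fin D.p) (h : ∃ l, D.conjPair l = D.conjPair k) : j h.choose = j k :=
      hj _ _ ((D.conjPair_eq_iff _ _).mp h.choose_spec)
    have h2 (k : Fin D.q) (h : ∃ l, D.x l = D.x k) : i h.choose = i k := hi _ _ h.choose_spec
    rw [ofLabels]
    congr 1
    · funext k
      refine Prod.ext ?_ ?_
      · exact congrArg (fun z => z.1) (h1 k ⟨k, rfl⟩)
      · rw [hσ k]
        exact congrArg (fun z => σ z.1) (h1 k ⟨k, rfl⟩)
    · funext l
      exact h2 l ⟨l, rfl⟩

/-- Since `σ` fixes the second branch, one element of `Fin 2` is free for each conjugate pair and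
each real eigenvalue. Real roots correspond to `σ = id`, pure imaginary ones to `σ = Fin.rev`. -/
theorem ncard_setOf_blockSqrt (hx : ∀ l, D.x l ≠ 0) (σ : Fin 2 → Fin 2) :
    {X | ∃ j i, D.Admissible j i ∧ (∀ k, (j k).2 = σ (j k).1) ∧
      X = D.blockSqrt j i}.ncard = 2 ^ (D.c + D.r) := by
  rw [← range_ofLabels, ← Set.image_univ,
    Set.ncard_image_of_injective _ (D.ofLabels_injective hx σ), Set.ncard_univ, Nat.card_prod,
    Nat.card_fun, Nat.card_fun, Nat.card_fin, Nat.card_coe_set_eq, Nat.card_coe_set_eq, pow_add]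
  rfl

end RealJordan

end

/-! ### Classification of the real and pure imaginary square roots -/

theorem mainTheorem6 (D : RealJordan) (hD : IsUnit D.toMatrix.det) :
    ((∃ t : ℝ, t < 0 ∧ IsEigenvalue D.toMatrix t) →
      ¬ ∃ X ∈ sqrtFunctions D.toComplex, IsRealMatrix X) ∧
    ((¬ ∃ t : ℝ, t < 0 ∧ IsEigenvalue D.toMatrix t) →
      {X | X ∈ sqrtFunctions D.toComplex ∧ IsRealMatrix X}.ncard = 2 ^ (D.c + D.r) ∧
      {X | X ∈ sqrtFunctions D.toComplex ∧ IsRealMatrix X} =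
        {X | ∃ j i, D.Admissible j i ∧
          (∀ k, IsRealMatrix (blockF (D.m k) (D.a k) (D.b k) (j k))) ∧
          X = D.blockSqrt j i}) ∧
    ((¬ ∃ t : ℝ, 0 < t ∧ IsEigenvalue D.toMatrix t) →
      {X | X ∈ sqrtFunctions D.toComplex ∧ IsPureImaginaryMatrix X}.ncard = 2 ^ (D.c + D.r) ∧
      {X | X ∈ sqrtFunctions D.toComplex ∧ IsPureImaginaryMatrix X} =
        {X | ∃ j i, D.Admissible j i ∧
          (∀ k, IsPureImaginaryMatrix (blockF (D.m k) (D.a k) (D.b k) (j k))) ∧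
          X = D.blockSqrt j i}) := by
  have hx := D.x_ne_zero_of_isUnit_det hD
  refine ⟨?_, fun hneg => ?_, fun hpos => ?_⟩
  · rintro ⟨t, ht, hev⟩ ⟨X, hX, hreal⟩
    obtain ⟨l, rfl⟩ := D.exists_x_eq_of_isEigenvalue hev
    obtain ⟨j, i, -, rfl⟩ := (D.mem_sqrtFunctions_toComplex_iff hx X).mp hX
    exact not_isRealMatrix_blockL ht (D.n_pos l) (i l) ((D.isRealMatrix_blockSqrt.mp hreal).2 l)
  · have hx' (l : Fin D.q) : 0 < D.x l :=
      (hx l).lt_or_gt.resolve_left fun h => hneg ⟨_, h, D.isEigenvalue_x l⟩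
    have heq : {X | X ∈ sqrtFunctions D.toComplex ∧ IsRealMatrix X} =
        {X | ∃ j i, D.Admissible j i ∧
          (∀ k, IsRealMatrix (blockF (D.m k) (D.a k) (D.b k) (j k))) ∧
          X = D.blockSqrt j i} := by
      ext X
      rw [Set.mem_ofPred_eq, D.mem_sqrtFunctions_toComplex_iff hx]
      constructor
      · rintro ⟨⟨j, i, hadm, rfl⟩, hX⟩
        exact ⟨j, i, hadm, (D.isRealMatrix_blockSqrt.mp hX).1, rfl⟩
      · rintro ⟨j, i, hadm, hF, rfl⟩
        exact ⟨⟨j, i, hadm, rfl⟩, D.isRealMatrix_blockSqrt.mpr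
          -- All real eigenvalues are positive here, so the blocks `L` impose no condition on the
          -- labels `i`.
          ⟨hF, fun l => isRealMatrix_blockL (hx' l) _ _⟩⟩
    refine ⟨?_, heq⟩
    rw [heq, ← D.ncard_setOf_blockSqrt hx id]
    simp only [isRealMatrix_blockF_iff (D.m_pos _) (D.b_ne_zero _), id]
  · have hx' (l : Fin D.q) : D.x l < 0 :=
      (hx l).lt_or_gt.resolve_right fun h => hpos ⟨_, h, D.isEigenvalue_x l⟩
    have heq : {X | X ∈ sqrtFunctions D.toComplex ∧ IsPureImaginaryMatrix X} =
        {X | ∃ j i, D.Admissible j i ∧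
          (∀ k, IsPureImaginaryMatrix (blockF (D.m k) (D.a k) (D.b k) (j k))) ∧
          X = D.blockSqrt j i} := by
      ext X
      rw [Set.mem_ofPred_eq, D.mem_sqrtFunctions_toComplex_iff hx]
      constructor
      · rintro ⟨⟨j, i, hadm, rfl⟩, hX⟩
        exact ⟨j, i, hadm, (D.isPureImaginaryMatrix_blockSqrt.mp hX).1, rfl⟩
      · rintro ⟨j, i, hadm, hF, rfl⟩
        exact ⟨⟨j, i, hadm, rfl⟩, D.isPureImaginaryMatrix_blockSqrt.mpr
          ⟨hF, fun l => isPureImaginaryMatrix_blockL (hx' l) _ _⟩⟩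
    refine ⟨?_, heq⟩
    rw [heq, ← D.ncard_setOf_blockSqrt hx Fin.rev]
    simp only [isPureImaginaryMatrix_blockF_iff (D.m_pos _) (D.b_ne_zero _)]
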